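/- \textbf{Model.} There are $n$ players, each with one packet, $k$ channels, and time slots $t=1,2,\dots$. In each slot every pending player chooses an action in $A=\{0,1,\dots,k\}$, where $0$ means no transmission and $a\geq 1$ means transmitting on channel $a$. A player who is the only one transmitting on some channel in slot $t$ is successful and leaves the game (she never transmits again); all other players that were pending remain pending. Let $X_{i,t}\in A$ be the action of player $i$ in slot $t$ ($0$ after she has left), let $h_{i,t}=(X_{i,1},\dots,X_{i,t})$ be her personal history, and let $h_t=(h_{1,t},\dots,h_{n,t})$ be the transmission history of all players. An acknowledgement-based protocol $f_i$ of player $i$ assigns to every $t\geq 1$ and every personal history $h_{i,t-1}$ a probability distribution on $A$, according to which she chooses $X_{i,t}$ if she is pending; given $h_{t-1}$, the players randomize independently. The latency $T_i\in\{1,2,\dots\}\cup\{\infty\}$ is the first slot in which player $i$ is successful. A profile $\vec f=(f_1,\dots,f_n)$ is an \emph{equilibrium} if for every $t\geq 0$, every transmission history $h_t$ that can occur in the game, every player $i$ that is pending after $h_t$, and every acknowledgement-based protocol $f_i'$, $$\mathbb E[T_i\mid h_t,\vec f]\ \leq\ \mathbb E[T_i\mid h_t,(\vec f_{-i},f_i')],$$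 where from slot $t+1$ on the players use the indicated profile. It is an \emph{equilibrium with respect to personal histories} if the same inequality holds with conditioning on $h_t$ replaced by conditioning on the personal history $h_{i,t}$ and on player $i$ being pending after slot $t$ (the other players following $\vec f_{-i}$ from the start), whenever that event has positive probability when player $i$ plays the actions of $h_{i,t}$. Both notions contain, for $t=0$, the inequality $\mathbb E[T_i\mid\vec f]\leq\mathbb E[T_i\mid(\vec f_{-i},f_i')]$. Let $f^2$ be the memoryless protocol for $k=2$ channels that in every slot, for every history, transmits on each of the two channels with probability $1/2$ (and so never abstains). \textbf{Theorem.} Let $k=2$. For $n\in\{2,3,4\}$ players, the profile in which every player uses $f^2$ is an equilibrium among acknowledgement-based protocols, both with conditioning on the histories of all players and with conditioning on personal histories. The expected latency $\mathbb E[T_i\mid (f^2,\dots,f^2)]$ of every player $i$ is $2$ for $n=2$, $8/3$ for $n=3$, and $4$ for $n=4$. -/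

import Mathlib

open MeasureTheory ProbabilityTheory
open scoped ENNReal

noncomputable section

namespace ContentionGame

/-- The pure strategies of a pending player: `0` is "no transmission", and `c.succ` is
"transmit on channel `c`" for `c : Fin k`. -/
abbrev Act (k : ℕ) : Type := Fin (k + 1)

/-- A transmission vector: the actions of all `n` players in one time slot. -/
abbrev TransVec (n k : ℕ) : Type := Fin n → Act k

/-- An acknowledgement-based protocol: the decision rule for slot `t + 1` maps the personal
transmission history `(X_1, …, X_t)` of a pending player to a probability distribution on the
actions. -/
abbrev Protocol (k : ℕ) : Type := (t : ℕ) → (Fin t → Act k) → PMF (Act k)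

/-- A protocol profile. -/
abbrev Profile (n k : ℕ) : Type := Fin n → Protocol k

/-- The memoryless protocol `f ^ k`: in every slot, whatever the history, transmit on a channel
chosen uniformly at random; "no transmission" has probability zero. -/
def unifProtocol (k : ℕ) [NeZero k] : Protocol k :=
  fun _ _ => (PMF.uniformOfFintype (Fin k)).map Fin.succ

/-- Player `i` is the only one who transmits on some channel. -/
def Succeeds {n k : ℕ} (x : TransVec n k) (i : Fin n) : Prop :=
  ∃ c : Fin k, x i = c.succ ∧ ∀ j, j ≠ i → x j ≠ c.succ

/-- A sequence of transmission vectors for the slots `1, …, t`. Coordinate `0` is a formal slot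
before the game starts, see `IsHistory`. -/
abbrev Hist (n k t : ℕ) : Type := (s : Finset.Iic t) → TransVec n k

/-- Player `i` has not transmitted successfully up to slot `t`. -/
def Pending {n k t : ℕ} (h : Hist n k t) (i : Fin n) : Prop :=
  ∀ s, ¬ Succeeds (h s) i

/-- `h` is a transmission history of the game: nobody transmits in the formal slot `0`, and a
player who has transmitted successfully has left the game and does not transmit any more. -/
def IsHistory {n k t : ℕ} (h : Hist n k t) : Prop :=
  (∀ s : Finset.Iic t, s.1 = 0 → h s = 0) ∧
  ∀ (r s : Finset.Iic t) (i : Fin n), r.1 < s.1 → Succeeds (h r) i → h s i = 0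

/-- The personal transmission history `(X_{i,1}, …, X_{i,t})` of player `i`. -/
def personal {n k t : ℕ} (h : Hist n k t) (i : Fin n) : Fin t → Act k :=
  fun s => h ⟨s.1 + 1, Finset.mem_Iic.2 s.2⟩ i

open Classical in
/-- The distribution of the action of player `i` in slot `t + 1` after the history `h`: a pending
player follows her protocol, a player who has left the game does not transmit. -/
def actionDist {n k t : ℕ} (f : Profile n k) (h : Hist n k t) (i : Fin n) : PMF (Act k) :=
  if Pending h i then f i t (personal h i) else PMF.pure 0

/-- The transition kernel from histories up to slot `t` to the transmission vector of slot
`t + 1`: given the history, the players randomize independently. -/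
def stepKernel {n k : ℕ} (f : Profile n k) (t : ℕ) : Kernel (Hist n k t) (TransVec n k) :=
  Kernel.ofFunOfCountable fun h => Measure.pi fun i => (actionDist f h i).toMeasure

instance {n k : ℕ} (f : Profile n k) (t : ℕ) : IsMarkovKernel (stepKernel f t) :=
  ⟨fun h => by
    change IsProbabilityMeasure (Measure.pi fun i => (actionDist f h i).toMeasure)
    infer_instance⟩

/-- The law of the infinite sequence of transmission vectors, given the transmission history `h`
up to slot `t`, when from slot `t + 1` on the players follow the profile `f`. -/
def lawGiven {n k t : ℕ} (f : Profile n k) (h : Hist n k t) : Measure (ℕ → TransVec n k) :=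
  Kernel.traj (X := fun _ => TransVec n k) (stepKernel f) t h

/-- The empty history: only the formal slot `0`, in which nobody transmits. -/
def emptyHist (n k : ℕ) : Hist n k 0 := fun _ => 0

/-- The latency `T_i`: the first slot in which player `i` transmits successfully, `∞` if there is
none. -/
def latency {n k : ℕ} (i : Fin n) (ω : ℕ → TransVec n k) : ℝ≥0∞ :=
  ⨅ (t : ℕ) (_ : Succeeds (ω t) i), (t : ℝ≥0∞)

/-- `C_i^f(h_t) = E[T_i | h_t, f]`: the expected latency of player `i` given the transmission
history `h` of all players. -/
def expLatencyGiven {n k t : ℕ} (f : Profile n k) (i : Fin n) (h : Hist n k t) : ℝ≥0∞ :=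
  ∫⁻ ω, latency i ω ∂(lawGiven f h)

/-- `C_i^f(h_0)`: the unconditional expected latency of player `i`. -/
def expLatency {n k : ℕ} (f : Profile n k) (i : Fin n) : ℝ≥0∞ :=
  expLatencyGiven f i (emptyHist n k)

/-- `f` is an equilibrium: for every transmission history `h_t`, no player who is still pending
can decrease her expected latency, conditional on `h_t`, by unilaterally deviating after `t` to
another protocol. -/
def IsEquilibrium {n k : ℕ} (f : Profile n k) : Prop :=
  ∀ (i : Fin n) (t : ℕ) (h : Hist n k t), IsHistory h → Pending h i →
    ∀ g : Protocol k, expLatencyGiven f i h ≤ expLatencyGiven (Function.update f i g) i h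

/-- The protocol that plays the actions `a_1, …, a_τ` in the slots `1, …, τ` and follows `g`
afterwards. -/
def playThen {k τ : ℕ} (a : Fin τ → Act k) (g : Protocol k) : Protocol k :=
  fun t h => if ht : t < τ then PMF.pure (a ⟨t, ht⟩) else g t h

/-- The event that player `i` has personal transmission history `a_1, …, a_t` and is still pending
after slot `t`. -/
def personalEvent {n k t : ℕ} (i : Fin n) (a : Fin t → Act k) : Set (ℕ → TransVec n k) :=
  {ω | (∀ s : Fin t, ω (s.1 + 1) i = a s) ∧ ∀ s ≤ t, ¬ Succeeds (ω s) i}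

/-- The law of the play when player `i` has played `a_1, …, a_t` and follows `g` from slot `t + 1`
on, while every other player `j` uses `f j` all the time; not yet conditioned on player `i` being
still pending after slot `t`. -/
def personalLaw {n k t : ℕ} (f : Profile n k) (i : Fin n) (a : Fin t → Act k) (g : Protocol k) :
    Measure (ℕ → TransVec n k) :=
  lawGiven (Function.update f i (playThen a g)) (emptyHist n k)

/-- `E[T_i | h_{i,t}, (f_{-i}, g)]`: the expected latency of player `i` given that she is pending
and that her personal history is `a_1, …, a_t`, when from slot `t + 1` on she follows `g`. -/
def expLatencyGivenPersonal {n k t : ℕ} (f : Profile n k) (i : Fin n) (a : Fin t → Act k)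
    (g : Protocol k) : ℝ≥0∞ :=
  ∫⁻ ω, latency i ω ∂(ProbabilityTheory.cond (personalLaw f i a g) (personalEvent i a))

/-- The equilibrium condition with the expected latency conditional on what the deviating player
knows, which is her personal history: for every personal history after which she is pending with
positive probability (this does not depend on the protocol she uses afterwards), no player can
decrease her conditional expected latency by unilaterally deviating after `t`. -/
def IsPersonalEquilibrium {n k : ℕ} (f : Profile n k) : Prop :=
  ∀ (i : Fin n) (t : ℕ) (a : Fin t → Act k), personalLaw f i a (f i) (personalEvent i a) ≠ 0 →
    ∀ g : Protocol k, expLatencyGivenPersonal f i a (f i) ≤ expLatencyGivenPersonal f i a g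

end ContentionGame

end

/-!
The proof is dynamic programming. Against opponents who transmit uniformly on two channels, the
only thing that matters to a pending player is the number `m` of pending players, and if she
transmits uniformly as well, her expected remaining latency is `1`, `2`, `8 / 3`, `4` for
`m = 1, 2, 3, 4`. These values satisfy the Bellman equation: transmitting on either channel costs
one slot and loses exactly one in expected value, while abstaining is never better (it is equally
good for `m = 2` and `m = 4`, and worse for `m = 1` and `m = 3`). This is a finite computation,
`bellman_check`. Since the potential is a function of the set of pending players alone, the
equation holds at every sequence of transmission vectors, whether or not the game can produce it.

The latency is the sum over all slots of the indicator that the player is still pending, so summing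
the Bellman equation over the slots bounds the expected latency. For the uniform protocol the
partial sums are at most the potential (`tsum_le_of_add_le`). For an arbitrary protocol the
potential is at most a partial sum plus the expected potential left over at the end, which is at
most a multiple of the probability of being still pending; if the expected latency is finite this
probability tends to `0`, and otherwise there is nothing to show (`le_tsum_of_le_add`). This gives
the equilibrium property and the values given the history of all players (`add_potential_le`,
`three_mul_expLatencyGiven_unif`).

For personal histories, the distribution of the full history up to slot `t` does not depend on the
protocol used afterwards (`historyKernel_playThen`). By the Markov property
(`setLIntegral_personalLaw`) the conditional expectations are averages, with the same weights, of
expectations given a full history, and these compare pointwise.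
-/

namespace ContentionGame

/-! ### The potential and the Bellman inequality -/

instance {n k : ℕ} (x : TransVec n k) (i : Fin n) : Decidable (Succeeds x i) :=
  inferInstanceAs (Decidable (∃ c : Fin k, x i = c.succ ∧ ∀ j, j ≠ i → x j ≠ c.succ))

/-- Three times the expected remaining latency of a pending player when `m ≤ 4` players are pending
on two channels and all of them transmit uniformly; the factor `3` makes the values integral. -/
def tripleValue : ℕ → ℕ
  | 1 => 3
  | 2 => 6
  | 3 => 8
  | 4 => 12
  | _ => 0

/-- The potential of player `i` when `S` is the set of pending players: `tripleValue` of the number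
of pending players, and `0` once she has left. -/
def potential {n : ℕ} (i : Fin n) (S : Finset (Fin n)) : ℕ :=
  if i ∈ S then tripleValue S.card else 0

/-- The players of `S` who do not succeed with the transmission vector `x`. -/
def remaining {n k : ℕ} (S : Finset (Fin n)) (x : TransVec n k) : Finset (Fin n) :=
  S.filter fun j => ¬ Succeeds x j

/-- The action of player `j` when player `i` plays `a`, every other player of `S` transmits on the
channel drawn for her, and everyone else is silent. -/
def deviatedAction {n k : ℕ} (S : Finset (Fin n)) (i : Fin n) (a : Act k) (j : Fin n)
    (c : Fin k) : Act k :=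
  if j = i then a else if j ∈ S then c.succ else 0

theorem potential_of_mem {n : ℕ} {i : Fin n} {S : Finset (Fin n)} (h : i ∈ S) :
    potential i S = tripleValue S.card := if_pos h

/-- The finite computation behind the Bellman equation. For every set `S` of pending players and
every action `a` of player `i`, one slot and the average potential after it cost at least the
current potential, with equality if `a` transmits. Both sides are multiplied by the number `2 ^ n`
of equally likely channel assignments; the channel assigned to a player who does not use it is
averaged out. -/
theorem bellman_check : ∀ n ≤ 4, ∀ (S : Finset (Fin n)) (i : Fin n), i ∈ S → ∀ a : Act 2,
    2 ^ n * potential i S ≤ 2 ^ n * 3 + ∑ c : Fin n → Fin 2,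
      potential i (remaining S fun j => deviatedAction S i a j (c j)) ∧
    (a ≠ 0 → 2 ^ n * potential i S = 2 ^ n * 3 + ∑ c : Fin n → Fin 2,
      potential i (remaining S fun j => deviatedAction S i a j (c j))) := by
  decide +kernel

theorem tripleValue_le (m : ℕ) : tripleValue m ≤ 12 := by
  unfold tripleValue; split <;> decide

theorem potential_le {n : ℕ} (i : Fin n) (S : Finset (Fin n)) : potential i S ≤ 12 := by
  unfold potential; split
  · exact tripleValue_le _
  · exact Nat.zero_le _

open Classical in
/-- The players who are still pending after the history `h`. -/
noncomputable def pendingSet {n k t : ℕ} (h : Hist n k t) : Finset (Fin n) :=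
  Finset.univ.filter (Pending h)

@[simp]
theorem mem_pendingSet {n k t : ℕ} (h : Hist n k t) (i : Fin n) :
    i ∈ pendingSet h ↔ Pending h i := by
  simp [pendingSet]

/-! ### One slot against uniform opponents -/

theorem unifProtocol_apply {k : ℕ} [NeZero k] (t : ℕ) (h : Fin t → Act k) (y : Act k) :
    unifProtocol k t h y = ∑ c : Fin k, (k : ℝ≥0∞)⁻¹ * if c.succ = y then 1 else 0 := by
  classical
  simp only [unifProtocol, PMF.map_apply, PMF.uniformOfFintype_apply, tsum_fintype,
    Fintype.card_fin, mul_ite, mul_one, mul_zero, eq_comm]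

theorem sum_inv_mul_eq {k : ℕ} [NeZero k] (b : ℝ≥0∞) :
    ∑ _c : Fin k, (k : ℝ≥0∞)⁻¹ * b = b := by
  rw [Finset.sum_const, Finset.card_univ, Fintype.card_fin, nsmul_eq_mul, ← mul_assoc,
    ENNReal.mul_inv_cancel (by simp [NeZero.ne k]) (ENNReal.natCast_ne_top k), one_mul]

/-- When every player but `i` transmits uniformly, the next transmission vector is obtained by
drawing the action `a` of player `i` and, independently, a uniform channel for every player. -/
theorem lintegral_stepKernel {n k t : ℕ} [NeZero k] (f : Profile n k) (i : Fin n)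
    (hf : ∀ j, j ≠ i → f j = unifProtocol k) (h : Hist n k t) (hi : Pending h i)
    (F : TransVec n k → ℝ≥0∞) :
    ∫⁻ x, F x ∂(stepKernel f t h) = ∑ a, f i t (personal h i) a *
      ((k : ℝ≥0∞) ^ n)⁻¹ * ∑ c : Fin n → Fin k,
        F fun j => deviatedAction (pendingSet h) i a j (c j) := by
  classical
  set D := deviatedAction (pendingSet h) i with hD
  have other : ∀ j, j ≠ i → ∀ a y, actionDist f h j y =
      ∑ c : Fin k, (k : ℝ≥0∞)⁻¹ * if D a j c = y then 1 else 0 := by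
    intro j hj a y
    simp only [hD, deviatedAction, if_neg hj, mem_pendingSet, actionDist]
    split
    · rw [hf j hj, unifProtocol_apply]
    · rw [sum_inv_mul_eq, PMF.pure_apply]
      by_cases hy : y = 0
      · simp [hy]
      · simp [hy, Ne.symm hy]
  -- Player `i` plays `a` whatever channel is drawn for her.
  have self : ∀ a y, ∑ c : Fin k, (k : ℝ≥0∞)⁻¹ * (if D a i c = y then 1 else 0) =
      if a = y then 1 else 0 := by
    intro a y
    simp only [hD, deviatedAction, if_true]
    rw [sum_inv_mul_eq]
  -- Condition on the action of player `i` and expand the product of the sums over channels.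
  have joint : ∀ x : TransVec n k, ∏ j, actionDist f h j (x j) =
      ∑ a, f i t (personal h i) a * ((k : ℝ≥0∞) ^ n)⁻¹ *
        ∑ c : Fin n → Fin k, if (fun j => D a j (c j)) = x then 1 else 0 := by
    intro x
    have prod_eq : ∀ a, ∏ j, ∑ c : Fin k, (k : ℝ≥0∞)⁻¹ * (if D a j c = x j then 1 else 0) =
        ((k : ℝ≥0∞) ^ n)⁻¹ * ∑ c : Fin n → Fin k, if (fun j => D a j (c j)) = x then 1 else 0 := by
      intro a
      rw [Finset.prod_univ_sum, Fintype.piFinset_univ, Finset.mul_sum]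
      refine Finset.sum_congr rfl fun c _ => ?_
      rw [Finset.prod_mul_distrib, Finset.prod_const, Finset.card_univ, Fintype.card_fin,
        ENNReal.inv_pow, Finset.prod_ite_zero]
      simp [funext_iff]
    simp_rw [mul_assoc, ← prod_eq, ← Finset.mul_prod_erase _ _ (Finset.mem_univ i), self]
    rw [Finset.sum_eq_single (x i) (fun a _ ha => by simp [ha]) (by simp)]
    rw [if_pos rfl, one_mul]
    congr 1
    · simp [actionDist, hi]
    · exact Finset.prod_congr rfl fun j hj => other j (Finset.ne_of_mem_erase hj) _ _
  have point : ∀ x : TransVec n k, stepKernel f t h {x} = ∏ j, actionDist f h j (x j) := by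
    intro x
    change Measure.pi (fun j => (actionDist f h j).toMeasure) {x} = _
    rw [Measure.pi_singleton]
    exact Finset.prod_congr rfl fun j _ =>
      PMF.toMeasure_apply_singleton _ _ (measurableSet_singleton _)
  rw [lintegral_fintype]
  simp_rw [point, joint, Finset.mul_sum]
  rw [Finset.sum_comm]
  refine Finset.sum_congr rfl fun a _ => ?_
  rw [Finset.sum_comm]
  refine Finset.sum_congr rfl fun c _ => ?_
  rw [Finset.sum_eq_single (fun j => D a j (c j)) (fun x _ hx => by simp [hx.symm]) (by simp)]
  simp [mul_comm]

/-- The cost of one slot in the scale of the potential: three units while player `i` is pending. -/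
noncomputable def slotCost {n k t : ℕ} (i : Fin n) (h : Hist n k t) : ℝ≥0∞ :=
  if i ∈ pendingSet h then 3 else 0

/-- The cost of the next slot plus the expected potential after it, when `S` is the set of pending
players, player `i` plays `a`, and everyone else transmits uniformly. -/
noncomputable def actionCost {n : ℕ} (S : Finset (Fin n)) (i : Fin n) (a : Act 2) : ℝ≥0∞ :=
  3 + (((2 : ℕ) : ℝ≥0∞) ^ n)⁻¹ * ∑ c : Fin n → Fin 2,
    (potential i (remaining S fun j => deviatedAction S i a j (c j)) : ℝ≥0∞)

theorem two_pow_mul_actionCost {n : ℕ} (S : Finset (Fin n)) (i : Fin n) (a : Act 2) :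
    (2 : ℝ≥0∞) ^ n * actionCost S i a = ((2 ^ n * 3 + ∑ c : Fin n → Fin 2,
      potential i (remaining S fun j => deviatedAction S i a j (c j)) : ℕ) : ℝ≥0∞) := by
  rw [actionCost, Nat.cast_ofNat, mul_add, ← mul_assoc,
    ENNReal.mul_inv_cancel (by simp) (by finiteness), one_mul]
  push_cast
  rfl

theorem potential_le_actionCost {n : ℕ} (hn : n ≤ 4) {S : Finset (Fin n)} {i : Fin n}
    (hi : i ∈ S) (a : Act 2) : (potential i S : ℝ≥0∞) ≤ actionCost S i a := by
  rw [← ENNReal.mul_le_mul_iff_right (a := 2 ^ n) (by simp) (by finiteness),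
    two_pow_mul_actionCost]
  exact_mod_cast (bellman_check n hn S i hi a).1

theorem potential_eq_actionCost {n : ℕ} (hn : n ≤ 4) {S : Finset (Fin n)} {i : Fin n}
    (hi : i ∈ S) {a : Act 2} (ha : a ≠ 0) : (potential i S : ℝ≥0∞) = actionCost S i a := by
  rw [← ENNReal.mul_right_inj (a := 2 ^ n) (by simp) (by finiteness), two_pow_mul_actionCost]
  exact_mod_cast (bellman_check n hn S i hi a).2 ha

theorem sum_pmf {α : Type*} [Fintype α] (p : PMF α) : ∑ a, p a = 1 := by
  rw [← tsum_fintype (L := .unconditional _)]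
  exact p.tsum_coe

theorem slotCost_add_lintegral {n t : ℕ} (f : Profile n 2) (i : Fin n)
    (hf : ∀ j, j ≠ i → f j = unifProtocol 2) (h : Hist n 2 t) (hi : i ∈ pendingSet h) :
    slotCost i h +
        ∫⁻ x, (potential i (remaining (pendingSet h) x) : ℝ≥0∞) ∂(stepKernel f t h) =
      ∑ a, f i t (personal h i) a * actionCost (pendingSet h) i a := by
  rw [lintegral_stepKernel f i hf h ((mem_pendingSet h i).1 hi), slotCost, if_pos hi]
  simp_rw [actionCost, mul_add, Finset.sum_add_distrib, ← Finset.sum_mul, sum_pmf, one_mul,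
    mul_assoc]

/-- The Bellman inequality: whatever player `i` does, the cost of one slot makes up for the expected
decrease of the potential. -/
theorem potential_le_lintegral {n t : ℕ} (hn : n ≤ 4) (f : Profile n 2) (i : Fin n)
    (hf : ∀ j, j ≠ i → f j = unifProtocol 2) (h : Hist n 2 t) :
    (potential i (pendingSet h) : ℝ≥0∞) ≤ slotCost i h +
      ∫⁻ x, (potential i (remaining (pendingSet h) x) : ℝ≥0∞) ∂(stepKernel f t h) := by
  by_cases hi : i ∈ pendingSet h
  · rw [slotCost_add_lintegral f i hf h hi, ← one_mul (potential i (pendingSet h) : ℝ≥0∞),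
      ← sum_pmf (f i t (personal h i)), Finset.sum_mul]
    exact Finset.sum_le_sum fun a _ => mul_le_mul_right (potential_le_actionCost hn hi a) _
  · simp [potential, hi]

/-- The uniform protocol attains equality in the Bellman inequality. -/
theorem potential_eq_lintegral {n t : ℕ} (hn : n ≤ 4) (f : Profile n 2) (i : Fin n)
    (hf : ∀ j, j ≠ i → f j = unifProtocol 2) (h : Hist n 2 t)
    (hfi : f i t (personal h i) = unifProtocol 2 t (personal h i)) :
    (potential i (pendingSet h) : ℝ≥0∞) = slotCost i h +
      ∫⁻ x, (potential i (remaining (pendingSet h) x) : ℝ≥0∞) ∂(stepKernel f t h) := by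
  by_cases hi : i ∈ pendingSet h
  · rw [slotCost_add_lintegral f i hf h hi, ← one_mul (potential i (pendingSet h) : ℝ≥0∞),
      ← sum_pmf (f i t (personal h i)), Finset.sum_mul]
    refine Finset.sum_congr rfl fun a _ => ?_
    by_cases ha : a = 0
    -- The uniform protocol never abstains, and abstaining may be strictly worse.
    · rw [hfi, ha, unifProtocol_apply]
      simp [Fin.succ_ne_zero]
    · rw [potential_eq_actionCost hn hi ha]
  · simp [potential, slotCost, remaining, hi]

/-! ### Summing one-step inequalities -/

theorem le_sum_add_of_le_add {P C : ℕ → ℝ≥0∞} (hPC : ∀ s, P s ≤ C s + P (s + 1)) (N : ℕ) :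
    P 0 ≤ ∑ s ∈ Finset.range N, C s + P N := by
  induction N with
  | zero => simp
  | succ N ih =>
    rw [Finset.sum_range_succ, add_assoc]
    exact ih.trans (add_le_add_right (hPC N) _)

/-- A potential `P` that decreases by at most the cost `C` in every step is bounded by the total
cost if it is dominated by the current cost, because it then vanishes in the limit whenever the
total cost is finite. -/
theorem le_tsum_of_le_add {P C : ℕ → ℝ≥0∞} (hPC : ∀ s, P s ≤ C s + P (s + 1))
    (hC : ∀ s, P s ≤ 4 * C s) : P 0 ≤ ∑' s, C s := by
  by_cases hfin : ∑' s, C s = ⊤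
  · simp [hfin]
  have hlim : Filter.Tendsto (fun N => ∑' s, C s + 4 * C N) Filter.atTop
      (nhds (∑' s, C s + 4 * 0)) :=
    tendsto_const_nhds.add (ENNReal.Tendsto.const_mul
      (ENNReal.tendsto_atTop_zero_of_tsum_ne_top hfin) (Or.inr (by simp)))
  rw [mul_zero, add_zero] at hlim
  exact ge_of_tendsto' hlim fun N => (le_sum_add_of_le_add hPC N).trans
    (add_le_add (ENNReal.sum_le_tsum _) (hC N))

theorem tsum_le_of_add_le {P C : ℕ → ℝ≥0∞} (hPC : ∀ s, C s + P (s + 1) ≤ P s) :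
    ∑' s, C s ≤ P 0 := by
  refine ENNReal.tsum_le_of_sum_range_le fun N => le_trans le_self_add (b :=
    ∑ s ∈ Finset.range N, C s + P N) ?_
  induction N with
  | zero => simp
  | succ N ih =>
    rw [Finset.sum_range_succ, add_assoc]
    exact (add_le_add_right (hPC N) _).trans ih

/-! ### Latency and the law of the play -/

/-- The history of the play `ω` up to slot `t`. -/
abbrev past {n k : ℕ} (t : ℕ) (ω : ℕ → TransVec n k) : Hist n k t :=
  Preorder.frestrictLe (π := fun _ => TransVec n k) t ω

theorem pending_past {n k : ℕ} (ω : ℕ → TransVec n k) (t : ℕ) (i : Fin n) :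
    Pending (past t ω) i ↔ ∀ s ≤ t, ¬ Succeeds (ω s) i := by
  simp [Pending]

theorem pendingSet_past_succ {n k : ℕ} (ω : ℕ → TransVec n k) (t : ℕ) :
    pendingSet (past (t + 1) ω) = remaining (pendingSet (past t ω)) (ω (t + 1)) := by
  ext j
  simp only [remaining, Finset.mem_filter, mem_pendingSet, pending_past]
  constructor
  · exact fun h => ⟨fun s hs => h s (by lia), h _ le_rfl⟩
  · rintro ⟨h, h'⟩ s hs
    obtain hs | rfl := Nat.le_or_eq_of_le_succ hs
    · exact h s hs
    · exact h'

/-- The latency is the number of slots, including the formal slot `0`, after which the player is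
still pending. -/
theorem three_mul_latency {n k : ℕ} (i : Fin n) (ω : ℕ → TransVec n k) :
    3 * latency i ω = ∑' s, slotCost i (past s ω) := by
  classical
  simp only [slotCost, mem_pendingSet, pending_past]
  by_cases hex : ∃ t, Succeeds (ω t) i
  · have hlat : latency i ω = (Nat.find hex : ℝ≥0∞) := by
      refine le_antisymm (iInf₂_le (f := fun t (_ : Succeeds (ω t) i) => (t : ℝ≥0∞))
        (Nat.find hex) (Nat.find_spec hex)) (le_iInf₂ fun t ht => ?_)
      exact_mod_cast Nat.find_min' hex ht
    have hiff : ∀ s, (∀ r ≤ s, ¬ Succeeds (ω r) i) ↔ s < Nat.find hex := fun s =>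
      (Nat.lt_find_iff hex s).symm
    simp_rw [hiff]
    rw [tsum_eq_sum (s := Finset.range (Nat.find hex)) (fun s hs => by
      simpa using hs), Finset.sum_congr rfl (fun s hs => if_pos (Finset.mem_range.1 hs)), hlat]
    simp [mul_comm]
  · push Not at hex
    have hlat : latency i ω = ⊤ := by simp [latency, hex]
    simp [hlat, hex]

theorem measurable_latency {n k : ℕ} (i : Fin n) : Measurable (latency (n := n) (k := k) i) :=
  Measurable.iInf fun t =>
    (Measurable.of_discrete (f := fun x : TransVec n k => ⨅ _ : Succeeds x i, (t : ℝ≥0∞))).comp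
      (measurable_pi_apply t)

instance {n k t : ℕ} (f : Profile n k) (h : Hist n k t) : IsProbabilityMeasure (lawGiven f h) := by
  unfold lawGiven; infer_instance

theorem measurable_past {n k : ℕ} (t : ℕ) : Measurable (past (n := n) (k := k) t) :=
  Preorder.measurable_frestrictLe (X := fun _ => TransVec n k) t

/-- The distribution of the history up to slot `b` when the players follow `f` after the history
up to slot `t`. -/
noncomputable abbrev historyKernel {n k : ℕ} (f : Profile n k) (t b : ℕ) :
    Kernel (Hist n k t) (Hist n k b) :=
  Kernel.partialTraj (X := fun _ => TransVec n k) (stepKernel f) t b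

theorem map_past_lawGiven {n k t : ℕ} (f : Profile n k) (h : Hist n k t) (b : ℕ) :
    (lawGiven f h).map (past b) = historyKernel f t b h :=
  Kernel.traj_map_frestrictLe_apply (X := fun _ => TransVec n k) (κ := stepKernel f) t b h

theorem ae_past_eq {n k t : ℕ} (f : Profile n k) (h : Hist n k t) :
    ∀ᵐ ω ∂(lawGiven f h), past t ω = h := by
  refine ae_of_ae_map (p := fun x => x = h) (measurable_past t).aemeasurable ?_
  rw [map_past_lawGiven, historyKernel, Kernel.partialTraj_self, Kernel.id_apply]
  simp [ae_dirac_eq]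

/-- The law of the slot `s + 1` given the first `s` slots is the step kernel. -/
theorem lintegral_lawGiven_succ {n k t s : ℕ} (hts : t ≤ s) (f : Profile n k) (h : Hist n k t)
    (F : Hist n k s → TransVec n k → ℝ≥0∞) :
    ∫⁻ ω, F (past s ω) (ω (s + 1)) ∂(lawGiven f h) =
      ∫⁻ ω, ∫⁻ x, F (past s ω) x ∂(stepKernel f s (past s ω)) ∂(lawGiven f h) := by
  have hmap : historyKernel f t s h ⊗ₘ stepKernel f s =
      (lawGiven f h).map fun ω => (past s ω, ω (s + 1)) :=
    Kernel.partialTraj_compProd_eq_map_traj (X := fun _ => TransVec n k) hts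
  have hF : Measurable fun q : Hist n k s × TransVec n k => F q.1 q.2 := Measurable.of_discrete
  have hmeas : Measurable fun ω : ℕ → TransVec n k => (past s ω, ω (s + 1)) :=
    (measurable_past s).prodMk (measurable_pi_apply _)
  calc ∫⁻ ω, F (past s ω) (ω (s + 1)) ∂(lawGiven f h)
      = ∫⁻ q, F q.1 q.2 ∂((lawGiven f h).map fun ω => (past s ω, ω (s + 1))) :=
        (lintegral_map hF hmeas).symm
    _ = ∫⁻ a, ∫⁻ x, F a x ∂(stepKernel f s a) ∂((lawGiven f h).map (past s)) := by
        rw [← hmap, Measure.lintegral_compProd hF, map_past_lawGiven]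
    _ = _ := lintegral_map Measurable.of_discrete (measurable_past s)

/-! ### Expected latency given the history of all players -/

/-- The expected cost of the slot after `s`, given the history `h`. -/
noncomputable def expCost {n k t : ℕ} (f : Profile n k) (i : Fin n) (h : Hist n k t) (s : ℕ) :
    ℝ≥0∞ :=
  ∫⁻ ω, slotCost i (past s ω) ∂(lawGiven f h)

/-- The expected potential after slot `s`, given the history `h`. -/
noncomputable def expPotential {n k t : ℕ} (f : Profile n k) (i : Fin n) (h : Hist n k t) (s : ℕ) :
    ℝ≥0∞ :=
  ∫⁻ ω, (potential i (pendingSet (past s ω)) : ℝ≥0∞) ∂(lawGiven f h)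

theorem measurable_slotCost_past {n k : ℕ} (i : Fin n) (s : ℕ) :
    Measurable fun ω : ℕ → TransVec n k => slotCost i (past s ω) :=
  (Measurable.of_discrete (f := fun h : Hist n k s => slotCost i h)).comp (measurable_past s)

theorem three_mul_expLatencyGiven {n k t : ℕ} (f : Profile n k) (i : Fin n) (h : Hist n k t) :
    3 * expLatencyGiven f i h = ∑' s, expCost f i h s := by
  rw [expLatencyGiven, ← lintegral_const_mul _ (measurable_latency i)]
  simp_rw [three_mul_latency]
  exact lintegral_tsum fun s => (measurable_slotCost_past i s).aemeasurable

/-- The slots up to `t` cost a player who is pending after slot `t` exactly `3 * t`. -/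
theorem three_mul_expLatencyGiven_eq_add {n k t : ℕ} (f : Profile n k) (i : Fin n)
    (h : Hist n k t) (hi : Pending h i) :
    3 * expLatencyGiven f i h = 3 * t + ∑' s, expCost f i h (t + s) := by
  rw [three_mul_expLatencyGiven, ← ENNReal.summable.sum_add_tsum_nat_add' (k := t)]
  simp_rw [add_comm t]
  congr 1
  have hone : ∀ s ∈ Finset.range t, expCost f i h s = 3 := by
    intro s hs
    rw [expCost, lintegral_congr_ae (g := fun _ => 3)]
    · simp
    · filter_upwards [ae_past_eq f h] with ω hω
      rw [← hω, pending_past] at hi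
      rw [slotCost, if_pos]
      rw [mem_pendingSet, pending_past]
      exact fun r hr => hi r (hr.trans (Finset.mem_range.1 hs).le)
  rw [Finset.sum_congr rfl hone]
  simp [mul_comm]

theorem expPotential_self {n k t : ℕ} (f : Profile n k) (i : Fin n) (h : Hist n k t) :
    expPotential f i h t = potential i (pendingSet h) := by
  rw [expPotential, lintegral_congr_ae (g := fun _ => (potential i (pendingSet h) : ℝ≥0∞))]
  · simp
  · filter_upwards [ae_past_eq f h] with ω hω
    rw [hω]

theorem expCost_add_expPotential_succ {n k t s : ℕ} (hts : t ≤ s) (f : Profile n k) (i : Fin n)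
    (h : Hist n k t) :
    expCost f i h s + expPotential f i h (s + 1) = ∫⁻ ω, slotCost i (past s ω) +
      ∫⁻ x, (potential i (remaining (pendingSet (past s ω)) x) : ℝ≥0∞)
        ∂(stepKernel f s (past s ω)) ∂(lawGiven f h) := by
  rw [lintegral_add_left (measurable_slotCost_past i s), ← lintegral_lawGiven_succ hts f h
    (fun a x => (potential i (remaining (pendingSet a) x) : ℝ≥0∞)), expCost, expPotential]
  simp_rw [pendingSet_past_succ]

theorem expPotential_le_four_mul_expCost {n k t : ℕ} (f : Profile n k) (i : Fin n)
    (h : Hist n k t) (s : ℕ) : expPotential f i h s ≤ 4 * expCost f i h s := by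
  rw [expCost, ← lintegral_const_mul _ (measurable_slotCost_past i s)]
  refine lintegral_mono fun ω => ?_
  by_cases hmem : i ∈ pendingSet (past s ω)
  -- The potential is at most `12`, four times the cost `3` of a slot.
  · simp only [slotCost, if_pos hmem]
    exact_mod_cast potential_le i _
  · simp [potential, hmem]

/-- Against uniform opponents, no protocol beats the value given by the potential. -/
theorem add_potential_le {n t : ℕ} (hn : n ≤ 4) (f : Profile n 2) (i : Fin n)
    (hf : ∀ j, j ≠ i → f j = unifProtocol 2) (h : Hist n 2 t) (hi : Pending h i) :
    (3 * t + potential i (pendingSet h) : ℝ≥0∞) ≤ 3 * expLatencyGiven f i h := by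
  rw [three_mul_expLatencyGiven_eq_add f i h hi, ← expPotential_self f i h]
  refine add_le_add_right (le_tsum_of_le_add (P := fun s => expPotential f i h (t + s))
    (fun s => ?_) fun s => expPotential_le_four_mul_expCost f i h _) _
  exact (lintegral_mono fun ω => potential_le_lintegral hn f i hf _).trans_eq
    (expCost_add_expPotential_succ (Nat.le_add_right t s) f i h).symm

/-- The uniform protocol attains the value given by the potential; only what player `i` does from
slot `t + 1` on matters. -/
theorem three_mul_expLatencyGiven_unif {n t : ℕ} (hn : n ≤ 4) (f : Profile n 2) (i : Fin n)
    (hf : ∀ j, j ≠ i → f j = unifProtocol 2) (hfi : ∀ s, t ≤ s → f i s = unifProtocol 2 s)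
    (h : Hist n 2 t) (hi : Pending h i) :
    3 * expLatencyGiven f i h = 3 * t + potential i (pendingSet h) := by
  refine le_antisymm ?_ (add_potential_le hn f i hf h hi)
  rw [three_mul_expLatencyGiven_eq_add f i h hi, ← expPotential_self f i h]
  refine add_le_add_right (tsum_le_of_add_le (P := fun s => expPotential f i h (t + s))
    fun s => ?_) _
  exact (expCost_add_expPotential_succ (Nat.le_add_right t s) f i h).trans_le
    (lintegral_mono fun ω => (potential_eq_lintegral hn f i hf _
      (by rw [hfi _ (Nat.le_add_right t s)])).ge)

/-! ### Expected latency given a personal history -/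

theorem historyKernel_congr {n k : ℕ} {f g : Profile n k} {t b : ℕ} (htb : t ≤ b)
    (hfg : ∀ s < b, stepKernel f s = stepKernel g s) :
    historyKernel f t b = historyKernel g t b := by
  induction b, htb using Nat.le_induction with
  | base => simp
  | succ b hb ih =>
    rw [historyKernel, historyKernel, Kernel.partialTraj_succ_of_le hb,
      Kernel.partialTraj_succ_of_le hb,
      show Kernel.partialTraj _ t b = _ from ih fun s hs => hfg s (by lia), hfg b (by lia)]

theorem stepKernel_congr {n k t : ℕ} {f g : Profile n k} (hfg : ∀ j, f j t = g j t) :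
    stepKernel f t = stepKernel g t := by
  ext h : 1
  change Measure.pi (fun j => (actionDist f h j).toMeasure) =
    Measure.pi (fun j => (actionDist g h j).toMeasure)
  simp only [actionDist, hfg]

/-- The distribution of the history up to slot `t` does not depend on what player `i` does
afterwards. -/
theorem historyKernel_playThen {n k t : ℕ} (f : Profile n k) (i : Fin n) (a : Fin t → Act k)
    (g g' : Protocol k) :
    historyKernel (Function.update f i (playThen a g)) 0 t =
      historyKernel (Function.update f i (playThen a g')) 0 t := by
  refine historyKernel_congr (Nat.zero_le t) fun s hs => stepKernel_congr fun j => ?_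
  by_cases hj : j = i
  · subst hj
    funext h
    simp [playThen, hs]
  · simp [hj]

/-- The histories up to slot `t` that belong to `personalEvent`. -/
def personalHists {n k t : ℕ} (i : Fin n) (a : Fin t → Act k) : Set (Hist n k t) :=
  {h | personal h i = a ∧ Pending h i}

theorem personalEvent_eq_preimage {n k t : ℕ} (i : Fin n) (a : Fin t → Act k) :
    personalEvent i a = past (n := n) (k := k) t ⁻¹' personalHists i a := by
  ext ω
  simp [personalEvent, personalHists, pending_past, personal, funext_iff]

theorem personalLaw_personalEvent {n k t : ℕ} (f : Profile n k) (i : Fin n) (a : Fin t → Act k)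
    (g : Protocol k) : personalLaw f i a g (personalEvent i a) =
      historyKernel (Function.update f i (playThen a g)) 0 t (emptyHist n k)
        (personalHists i a) := by
  rw [personalLaw, ← map_past_lawGiven,
    Measure.map_apply (measurable_past t) MeasurableSet.of_discrete, personalEvent_eq_preimage]

/-- The Markov property: the latency on a personal history is obtained by averaging over the full
histories that are compatible with it. -/
theorem setLIntegral_personalLaw {n k t : ℕ} (f : Profile n k) (i : Fin n) (a : Fin t → Act k)
    (g : Protocol k) : ∫⁻ ω in personalEvent i a, latency i ω ∂(personalLaw f i a g) =
      ∫⁻ h in personalHists i a, expLatencyGiven (Function.update f i (playThen a g)) i h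
        ∂(historyKernel (Function.update f i (playThen a g)) 0 t (emptyHist n k)) := by
  set f' := Function.update f i (playThen a g)
  have hmap := Kernel.partialTraj_compProd_traj (X := fun _ => TransVec n k)
    (κ := stepKernel f') (Nat.zero_le t) (emptyHist n k)
  have hT : Measurable fun q : Hist n k t × (ℕ → TransVec n k) => latency i q.2 :=
    (measurable_latency i).comp measurable_snd
  have hS : MeasurableSet (personalHists (n := n) i a ×ˢ (Set.univ : Set (ℕ → TransVec n k))) :=
    MeasurableSet.of_discrete.prod MeasurableSet.univ
  have hpre : personalEvent i a = (fun ω => (past (n := n) (k := k) t ω, ω)) ⁻¹'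
      (personalHists i a ×ˢ Set.univ) := by
    rw [personalEvent_eq_preimage]; ext; simp
  have hmeas : Measurable fun ω => (past (n := n) (k := k) t ω, ω) :=
    (measurable_past t).prodMk measurable_id
  calc _ = ∫⁻ q in personalHists i a ×ˢ Set.univ, latency i q.2
          ∂((personalLaw f i a g).map fun ω => (past (n := n) (k := k) t ω, ω)) := by
        rw [setLIntegral_map hS hT hmeas, hpre]
    _ = ∫⁻ q in personalHists i a ×ˢ Set.univ, latency i q.2
          ∂(historyKernel f' 0 t (emptyHist n k) ⊗ₘ
            (Kernel.traj (X := fun _ => TransVec n k) (stepKernel f') t)) := by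
        rw [hmap]; rfl
    _ = _ := by
        rw [Measure.setLIntegral_compProd hT MeasurableSet.of_discrete MeasurableSet.univ]
        simp only [Measure.restrict_univ]
        rfl

/-! ### Equilibrium and the value of the game -/

theorem three_mul_le_three_mul {x y : ℝ≥0∞} : 3 * x ≤ 3 * y ↔ x ≤ y :=
  ENNReal.mul_le_mul_iff_right (by simp) (by simp)

theorem isEquilibrium_unif {n : ℕ} (hn : n ≤ 4) :
    IsEquilibrium (fun _ : Fin n => unifProtocol 2) := by
  intro i t h _ hi g
  rw [← three_mul_le_three_mul,
    three_mul_expLatencyGiven_unif hn _ i (fun _ _ => rfl) (fun _ _ => rfl) h hi]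
  exact add_potential_le hn _ i (fun j hj => by simp [hj]) h hi

theorem isPersonalEquilibrium_unif {n : ℕ} (hn : n ≤ 4) :
    IsPersonalEquilibrium (fun _ : Fin n => unifProtocol 2) := by
  intro i t a _ g
  set u : Profile n 2 := fun _ => unifProtocol 2
  have hother : ∀ g' : Protocol 2, ∀ j, j ≠ i →
      Function.update u i (playThen a g') j = unifProtocol 2 := fun g' j hj => by simp [hj, u]
  simp only [expLatencyGivenPersonal, ProbabilityTheory.cond, lintegral_smul_measure, smul_eq_mul]
  rw [setLIntegral_personalLaw, setLIntegral_personalLaw, personalLaw_personalEvent,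
    personalLaw_personalEvent, historyKernel_playThen u i a (u i) g]
  refine mul_le_mul_right (setLIntegral_mono Measurable.of_discrete fun h hh => ?_) _
  rw [← three_mul_le_three_mul, three_mul_expLatencyGiven_unif hn _ i (hother _)
    (fun s hs => by funext; simp [playThen, u, not_lt.2 hs]) h hh.2]
  exact add_potential_le hn _ i (hother g) h hh.2

theorem pending_emptyHist {n k : ℕ} (i : Fin n) : Pending (emptyHist n k) i := by
  rintro s ⟨c, hc, -⟩
  exact (Fin.succ_ne_zero c).symm hc

theorem three_mul_expLatency_unif {n : ℕ} (hn : n ≤ 4) (i : Fin n) :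
    3 * expLatency (fun _ : Fin n => unifProtocol 2) i = tripleValue n := by
  have hS : pendingSet (emptyHist n 2) = Finset.univ := by
    ext j; simp [pending_emptyHist]
  rw [expLatency, three_mul_expLatencyGiven_unif hn _ i (fun _ _ => rfl) (fun _ _ => rfl) _
    (pending_emptyHist i), hS, potential_of_mem (Finset.mem_univ i)]
  simp

theorem expLatency_unif {n : ℕ} (hn : n ≤ 4) (i : Fin n) :
    expLatency (fun _ : Fin n => unifProtocol 2) i = tripleValue n / 3 :=
  ENNReal.eq_div_iff (by simp) (by simp) |>.2 (three_mul_expLatency_unif hn i)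

end ContentionGame

theorem mainTheorem3 :
    (∀ n : ℕ, n = 2 ∨ n = 3 ∨ n = 4 →
      ContentionGame.IsEquilibrium
        (fun _ : Fin n => ContentionGame.unifProtocol 2) ∧
      ContentionGame.IsPersonalEquilibrium
        (fun _ : Fin n => ContentionGame.unifProtocol 2)) ∧
    (∀ i : Fin 2, ContentionGame.expLatency
      (fun _ : Fin 2 => ContentionGame.unifProtocol 2) i = 2) ∧
    (∀ i : Fin 3, ContentionGame.expLatency
      (fun _ : Fin 3 => ContentionGame.unifProtocol 2) i = 8 / 3) ∧
    (∀ i : Fin 4, ContentionGame.expLatency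
      (fun _ : Fin 4 => ContentionGame.unifProtocol 2) i = 4) := by
  refine ⟨fun n hn => ?_, fun i => ?_, fun i => ?_, fun i => ?_⟩
  · have hn4 : n ≤ 4 := by lia
    exact ⟨ContentionGame.isEquilibrium_unif hn4, ContentionGame.isPersonalEquilibrium_unif hn4⟩
  · rw [ContentionGame.expLatency_unif (by norm_num) i, eq_comm,
      ENNReal.eq_div_iff (by simp) (by simp)]
    norm_num [ContentionGame.tripleValue]
  · exact ContentionGame.expLatency_unif (by norm_num) i
  · rw [ContentionGame.expLatency_unif (by norm_num) i, eq_comm,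
      ENNReal.eq_div_iff (by simp) (by simp)]
    norm_num [ContentionGame.tripleValue]
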